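/- Multigraphs here have a finite vertex set and may have loops and multiple edges. A cycle may have length one (a loop) or two (a pair of parallel edges), and cycles are called disjoint if they have no vertex in common. For a multigraph $G$, let $V_1=V_1(G)$ be the set of vertices incident to a loop; let $F=F(G)$ be the simple graph in which two distinct vertices $x,y\in V(G)\setminus V_1$ are adjacent if and only if they are joined by at least two edges of $G$; and let $\alpha'=\alpha'(F)$ be the maximum number of edges in a matching of $F$. Let $k\ge 2$ be an integer and let $G$ be a multigraph with at least one loop in which every vertex $v$ has at least $2k-1$ distinct neighbours other than $v$ itself. Then $G$ does not contain $k$ pairwise disjoint cycles if and only if $$|V(G)|+2|V_1|+\alpha'<3k.$$ -/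

import Mathlib

open scoped Graph

namespace Graph

/-- The set `V₁(G)` of the vertices of `G` incident to a loop. -/
def loopVertices {α β : Type*} (G : Graph α β) : Set α :=
  {v | ∃ e, G.IsLoopAt e v}

/-- The simple degree of `v`: the number of neighbours of `v`, i.e. of distinct vertices other
than `v` joined to `v` by an edge. -/
noncomputable def simpleDegree {α β : Type*} (G : Graph α β) (v : α) : ℕ :=
  {w : α | w ≠ v ∧ G.Adj v w}.ncard

/-- The simple graph `F(G)` of the strong edges of `G`: two distinct vertices, neither of them
incident to a loop, are adjacent if and only if at least two edges of `G` join them. -/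
def strongGraph {α β : Type*} (G : Graph α β) : SimpleGraph α where
  Adj x y := x ≠ y ∧ x ∉ G.loopVertices ∧ y ∉ G.loopVertices ∧
    ∃ e f, e ≠ f ∧ G.IsLink e x y ∧ G.IsLink f x y
  symm := ⟨fun _ _ ⟨hne, hx, hy, e, f, hef, he, hf⟩ =>
    ⟨hne.symm, hy, hx, e, f, hef, he.symm, hf.symm⟩⟩
  loopless := ⟨fun _ h => h.1 rfl⟩

/-- A cycle of length `n + 1` in a multigraph: distinct vertices `v₀, …, vₙ` and distinct edges
`e₀, …, eₙ` such that `eᵢ` joins `vᵢ` to `vᵢ₊₁`, with indices modulo `n + 1`. A cycle of length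
one is a loop, and a cycle of length two is a pair of parallel edges. -/
structure Cycle {α β : Type*} (G : Graph α β) where
  /-- the length of the cycle, minus one -/
  n : ℕ
  /-- the vertices, in cyclic order -/
  vert : Fin (n + 1) → α
  /-- the edges, in cyclic order -/
  edge : Fin (n + 1) → β
  vert_injective : Function.Injective vert
  edge_injective : Function.Injective edge
  isLink : ∀ i, G.IsLink (edge i) (vert i) (vert (i + 1))

/-- `G` contains `k` (pairwise vertex-)disjoint cycles. -/
def HasDisjointCycles {α β : Type*} (G : Graph α β) (k : ℕ) : Prop :=
  ∃ C : Fin k → G.Cycle,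
    Pairwise fun i j => Disjoint (Set.range (C i).vert) (Set.range (C j).vert)

end Graph

/-- The matching number `α'(F)`: the largest number of edges in a matching of `F` (for a graph `F`
with finitely many edges). -/
noncomputable def SimpleGraph.matchingNumber {V : Type*} (F : SimpleGraph V) : ℕ :=
  sSup {m : ℕ | ∃ M : F.Subgraph, M.IsMatching ∧ M.edgeSet.ncard = m}

section DisjointCycles

open scoped Classical

namespace SimpleGraph

variable {α : Type*} {G : SimpleGraph α} {S T : Finset α}

/-- The number of neighbours of `x` in the finite set `S`. -/
noncomputable def degIn (G : SimpleGraph α) (S : Finset α) (x : α) : ℕ :=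
  (S.filter (G.Adj x)).card

/-- A nonempty finite set inducing a subgraph of minimum degree at least two. -/
structure IsCore (G : SimpleGraph α) (T : Finset α) : Prop where
  nonempty : T.Nonempty
  two_le : ∀ v ∈ T, 2 ≤ G.degIn T v

/-- The sum of the degrees of the subgraph induced by `S`. -/
noncomputable def degSum (G : SimpleGraph α) (S : Finset α) : ℕ :=
  ∑ v ∈ S, G.degIn S v

lemma degIn_le_card (x : α) : G.degIn S x ≤ S.card :=
  Finset.card_filter_le _ _

lemma degIn_insert {a : α} (ha : a ∉ S) (x : α) :
    G.degIn (insert a S) x = G.degIn S x + if G.Adj x a then 1 else 0 := by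
  unfold degIn
  rw [Finset.filter_insert]
  split_ifs
  · rw [Finset.card_insert_of_notMem (by simp [ha])]
  · simp

lemma degIn_erase {a : α} (ha : a ∈ S) (x : α) :
    G.degIn S x = G.degIn (S.erase a) x + if G.Adj x a then 1 else 0 := by
  conv_lhs => rw [← Finset.insert_erase ha]
  exact degIn_insert (Finset.notMem_erase a S) x

lemma degIn_erase_self (x : α) : G.degIn (S.erase x) x = G.degIn S x := by
  by_cases h : x ∈ S
  · simp [degIn_erase h]
  · rw [Finset.erase_eq_of_notMem h]

lemma degIn_union (h : Disjoint S T) (x : α) :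
    G.degIn (S ∪ T) x = G.degIn S x + G.degIn T x := by
  unfold degIn
  rw [Finset.filter_union, Finset.card_union_of_disjoint (Finset.disjoint_filter_filter h)]

lemma degIn_biUnion {𝒞 : Finset (Finset α)} (h : (𝒞 : Set (Finset α)).PairwiseDisjoint id)
    (x : α) : G.degIn (𝒞.biUnion id) x = ∑ C ∈ 𝒞, G.degIn C x := by
  unfold degIn
  rw [Finset.filter_biUnion, Finset.card_biUnion]
  · rfl
  · exact fun C hC D hD hne => Finset.disjoint_filter_filter (h hC hD hne)

lemma degIn_pos_iff {x : α} : 0 < G.degIn S x ↔ ∃ y ∈ S, G.Adj x y := by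
  simp [degIn, Finset.card_pos, Finset.filter_nonempty_iff]

lemma degIn_eq_zero_iff {x : α} : G.degIn S x = 0 ↔ ∀ y ∈ S, ¬ G.Adj x y := by
  simp [degIn, Finset.filter_eq_empty_iff]

lemma two_le_degIn {x y z : α} (hy : y ∈ S) (hz : z ∈ S) (hyz : y ≠ z) (hxy : G.Adj x y)
    (hxz : G.Adj x z) : 2 ≤ G.degIn S x := by
  rw [← Finset.card_pair hyz]
  refine Finset.card_le_card fun w hw => ?_
  simp only [Finset.mem_insert, Finset.mem_singleton] at hw
  rcases hw with rfl | rfl <;> simp [*]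

lemma degIn_lt_card {x : α} (h : x ∈ S) : G.degIn S x < S.card := by
  rw [← degIn_erase_self]
  exact (degIn_le_card x).trans_lt (Finset.card_erase_lt_of_mem h)

lemma adj_of_degIn_eq_card {x y : α} (h : S.card ≤ G.degIn S x) (hy : y ∈ S) : G.Adj x y :=
  (Finset.mem_filter.1 ((Finset.eq_of_subset_of_card_le (Finset.filter_subset _ _) h).symm ▸ hy)).2

lemma degIn_triple {a b c : α} (hab : a ≠ b) (hac : a ≠ c) (hbc : b ≠ c) (x : α) :
    G.degIn {a, b, c} x = (if G.Adj x a then 1 else 0) + (if G.Adj x b then 1 else 0) +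
      if G.Adj x c then 1 else 0 := by
  rw [degIn_insert (by simp [hab, hac]), degIn_insert (by simp [hbc])]
  simp only [degIn, Finset.filter_singleton]
  split_ifs <;> simp

lemma degSum_insert {a : α} (ha : a ∉ S) :
    G.degSum (insert a S) = G.degSum S + 2 * G.degIn S a := by
  unfold degSum
  rw [Finset.sum_insert ha, degIn_insert ha, Finset.sum_congr rfl fun x _ => degIn_insert ha x,
    Finset.sum_add_distrib, ← Finset.card_filter]
  have : (S.filter fun x => G.Adj x a) = S.filter (G.Adj a) := by
    ext x; simp [G.adj_comm]
  rw [this]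
  simp only [G.irrefl, if_false]
  unfold degIn
  ring

lemma degSum_erase {a : α} (ha : a ∈ S) :
    G.degSum S = G.degSum (S.erase a) + 2 * G.degIn S a := by
  conv_lhs => rw [← Finset.insert_erase ha]
  rw [degSum_insert (Finset.notMem_erase a S), degIn_erase_self]

lemma exists_degIn_le_one (hne : S.Nonempty) (hS : ∀ T ⊆ S, ¬ G.IsCore T) :
    ∃ v ∈ S, G.degIn S v ≤ 1 := by
  by_contra! h
  exact hS S subset_rfl ⟨hne, h⟩

lemma degSum_add_two_le (hne : S.Nonempty) (hS : ∀ T ⊆ S, ¬ G.IsCore T) :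
    G.degSum S + 2 ≤ 2 * S.card := by
  induction S using Finset.strongInduction with
  | H S ih =>
    obtain ⟨v, hv, hd⟩ := exists_degIn_le_one hne hS
    have h1 := degSum_erase (G := G) hv
    have h2 := Finset.card_erase_add_one hv
    rcases (S.erase v).eq_empty_or_nonempty with h | h
    · have h3 : G.degIn S v = 0 := by
        rw [← degIn_erase_self, h]; rfl
      have h4 : G.degSum (S.erase v) = 0 := by rw [h]; rfl
      omega
    · have := ih _ (Finset.erase_ssubset hv) h fun T hT => hS T (hT.trans (Finset.erase_subset _ _))
      omega

lemma exists_isCore_of_le_degSum (hne : S.Nonempty) (h : 2 * S.card ≤ G.degSum S) :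
    ∃ T ⊆ S, G.IsCore T := by
  by_contra! hS
  have := degSum_add_two_le hne hS
  omega

lemma IsCore.three_le_card (h : G.IsCore T) : 3 ≤ T.card := by
  obtain ⟨v, hv⟩ := h.nonempty
  have := h.two_le v hv
  have := degIn_lt_card (G := G) hv
  omega

lemma isCore_triple {a b c : α} (hab : G.Adj a b) (hac : G.Adj a c) (hbc : G.Adj b c) :
    G.IsCore {a, b, c} := by
  refine ⟨by simp, fun v hv => ?_⟩
  simp only [Finset.mem_insert, Finset.mem_singleton] at hv
  rcases hv with rfl | rfl | rfl
  · exact two_le_degIn (y := b) (z := c) (by simp) (by simp) hbc.ne hab hac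
  · exact two_le_degIn (y := a) (z := c) (by simp) (by simp) hac.ne hab.symm hbc
  · exact two_le_degIn (y := a) (z := b) (by simp) (by simp) hab.ne hac.symm hbc.symm

lemma IsCore.adj_of_card_eq_three (h : G.IsCore T) (hT : T.card = 3) {x y : α} (hx : x ∈ T)
    (hy : y ∈ T) (hxy : x ≠ y) : G.Adj x y := by
  have h1 := h.two_le x hx
  rw [← degIn_erase_self] at h1
  exact adj_of_degIn_eq_card (S := T.erase x) (by rw [Finset.card_erase_of_mem hx, hT]; omega)
    (Finset.mem_erase.2 ⟨hxy.symm, hy⟩)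

lemma IsCore.degIn_eq_two (h : G.IsCore T) (hmin : ∀ U ⊂ T, ¬ G.IsCore U) :
    ∀ v ∈ T, G.degIn T v = 2 := by
  obtain ⟨w, hw, hw2⟩ : ∃ w ∈ T, G.degIn T w ≤ 2 := by
    by_contra! h3
    obtain ⟨w, hw⟩ := h.nonempty
    refine hmin _ (Finset.erase_ssubset hw) ⟨?_, fun v hv => ?_⟩
    · rw [← Finset.card_pos, Finset.card_erase_of_mem hw]
      have := h.three_le_card
      omega
    · have h4 := h3 v (Finset.mem_of_mem_erase hv)
      rw [degIn_erase hw] at h4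
      split_ifs at h4 <;> omega
  have h3 := h.three_le_card
  have h4 := Finset.card_erase_add_one hw
  have h5 : G.degSum (T.erase w) + 2 ≤ 2 * (T.erase w).card :=
    degSum_add_two_le (Finset.card_pos.1 (by omega)) fun U hU =>
      hmin U (hU.trans_ssubset (Finset.erase_ssubset hw))
  have h6 := degSum_erase (G := G) hw
  have h7 : ∑ v ∈ T, 2 = ∑ v ∈ T, G.degIn T v := by
    refine le_antisymm (Finset.sum_le_sum h.two_le) ?_
    change G.degSum T ≤ _
    rw [Finset.sum_const, smul_eq_mul]
    omega
  intro v hv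
  exact ((Finset.sum_eq_sum_iff_of_le h.two_le).1 h7 v hv).symm

/-- A vertex with three neighbours on a chordless cycle of length at least four creates a shorter
cycle. -/
lemma IsCore.exists_smaller (h : G.IsCore T) (hmin : ∀ U ⊂ T, ¬ G.IsCore U) (hT : 4 ≤ T.card)
    {x : α} (hx : x ∉ T) (hd : 3 ≤ G.degIn T x) :
    ∃ U ⊆ insert x T, G.IsCore U ∧ U.card < T.card := by
  have h2 := h.degIn_eq_two hmin
  obtain ⟨w, hw, hxw⟩ := degIn_pos_iff.1 (show 0 < G.degIn T x by omega)
  obtain ⟨z, hz, hwz⟩ := degIn_pos_iff.1 (show 0 < G.degIn T w by rw [h2 w hw]; omega)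
  by_cases hxz : G.Adj x z
  · refine ⟨{x, w, z}, ?_, isCore_triple hxw hxz hwz, ?_⟩
    · intro y hy
      simp only [Finset.mem_insert, Finset.mem_singleton] at hy ⊢
      rcases hy with rfl | rfl | rfl <;> simp [*]
    · exact (Finset.card_le_three).trans_lt hT
  · have hzw : z ∈ T.erase w := Finset.mem_erase.2 ⟨hwz.ne', hz⟩
    set U := (T.erase w).erase z with hU
    have hxU : x ∉ U := by simp [hU, hx]
    have c1 := Finset.card_erase_add_one hw
    have c2 := Finset.card_erase_add_one hzw
    have c3 := Finset.card_insert_of_notMem hxU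
    have e0 : G.degSum T = 2 * T.card := by
      rw [degSum, Finset.sum_congr rfl h2, Finset.sum_const, smul_eq_mul, mul_comm]
    have e1 := degSum_erase (G := G) hw
    have e2 := degSum_erase (G := G) hzw
    have e3 := degSum_insert (G := G) hxU
    have d1 := degIn_erase (G := G) hw x
    have d2 := degIn_erase (G := G) hzw x
    have d3 := degIn_erase (G := G) hw z
    rw [if_pos hxw] at d1
    rw [if_neg hxz] at d2
    rw [if_pos hwz.symm, h2 z hz] at d3
    rw [h2 w hw] at e1
    rw [← hU] at c2 e2 d2
    obtain ⟨V, hV, hc⟩ := exists_isCore_of_le_degSum (G := G) (S := insert x U) (by simp)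
      (by omega)
    refine ⟨V, hV.trans (Finset.insert_subset_insert _ ?_), hc, ?_⟩
    · exact (Finset.erase_subset _ _).trans (Finset.erase_subset _ _)
    · have := Finset.card_le_card hV
      omega

lemma exists_adj_and_forall_adj {C : Finset α} (hC : C.card = 3) {u v : α}
    (h : 5 ≤ G.degIn C u + G.degIn C v) :
    ∃ x ∈ C, G.Adj u x ∧ ∀ y ∈ C, y ≠ x → G.Adj v y := by
  obtain ⟨a, b, c, hab, hac, hbc, rfl⟩ := Finset.card_eq_three.1 hC
  rw [degIn_triple hab hac hbc, degIn_triple hab hac hbc] at h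
  simp only [Finset.mem_insert, Finset.mem_singleton]
  grind

lemma exists_adj_adj_and_forall_adj {C : Finset α} (hC : C.card = 3) {u v w : α}
    (h : 7 ≤ G.degIn C u + G.degIn C v + G.degIn C w) :
    ∃ x ∈ C, (G.Adj u x ∧ G.Adj v x ∧ ∀ y ∈ C, y ≠ x → G.Adj w y) ∨
      (G.Adj u x ∧ G.Adj w x ∧ ∀ y ∈ C, y ≠ x → G.Adj v y) ∨
      (G.Adj v x ∧ G.Adj w x ∧ ∀ y ∈ C, y ≠ x → G.Adj u y) := by
  obtain ⟨a, b, c, hab, hac, hbc, rfl⟩ := Finset.card_eq_three.1 hC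
  rw [degIn_triple hab hac hbc, degIn_triple hab hac hbc, degIn_triple hab hac hbc] at h
  simp only [Finset.mem_insert, Finset.mem_singleton]
  grind

/-- A family of pairwise disjoint cores inside `S`. -/
structure IsPacking (G : SimpleGraph α) (S : Finset α) (𝒞 : Finset (Finset α)) : Prop where
  pairwiseDisjoint : (𝒞 : Set (Finset α)).PairwiseDisjoint id
  isCore : ∀ C ∈ 𝒞, G.IsCore C
  subset : ∀ C ∈ 𝒞, C ⊆ S

/-- The vertices of `S` outside all members of `𝒞`. -/
noncomputable def rest (S : Finset α) (𝒞 : Finset (Finset α)) : Finset α :=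
  S \ 𝒞.biUnion id

lemma mem_rest {𝒞 : Finset (Finset α)} {x : α} :
    x ∈ rest S 𝒞 ↔ x ∈ S ∧ ∀ C ∈ 𝒞, x ∉ C := by
  simp [rest]

namespace IsPacking

variable {𝒞 : Finset (Finset α)} {C D : Finset α}

lemma notMem (h : G.IsPacking S 𝒞) (hC : C ∈ 𝒞) (hD : D ∈ 𝒞) (hCD : C ≠ D) {x : α}
    (hx : x ∈ C) : x ∉ D :=
  Finset.disjoint_left.1 (h.pairwiseDisjoint hC hD hCD) hx

lemma degIn_eq (h : G.IsPacking S 𝒞) (x : α) :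
    G.degIn S x = G.degIn (rest S 𝒞) x + ∑ C ∈ 𝒞, G.degIn C x := by
  rw [← degIn_biUnion h.pairwiseDisjoint, rest, ← degIn_union Finset.sdiff_disjoint]
  congr 1
  exact (Finset.sdiff_union_of_subset (Finset.biUnion_subset.2 h.subset)).symm

lemma card_rest_add (h : G.IsPacking S 𝒞) :
    (rest S 𝒞).card + ∑ C ∈ 𝒞, C.card = S.card := by
  have h1 := Finset.card_biUnion (s := 𝒞) (t := id) fun C hC D hD hne =>
    h.pairwiseDisjoint hC hD hne
  simp only [id] at h1
  rw [← h1]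
  exact Finset.card_sdiff_add_card_eq_card (Finset.biUnion_subset.2 h.subset)

lemma insert (h : G.IsPacking S 𝒞) (hT : G.IsCore T) (hTR : T ⊆ rest S 𝒞) :
    G.IsPacking S (insert T 𝒞) ∧ (Insert.insert T 𝒞).card = 𝒞.card + 1 := by
  have hd : ∀ C ∈ 𝒞, Disjoint T C := fun C hC =>
    Finset.disjoint_left.2 fun x hx => (mem_rest.1 (hTR hx)).2 C hC
  refine ⟨⟨?_, ?_, ?_⟩, ?_⟩
  · rw [Finset.coe_insert]
    exact h.pairwiseDisjoint.insert fun C hC _ => hd C hC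
  · intro C hC
    rcases Finset.mem_insert.1 hC with rfl | hC
    exacts [hT, h.isCore C hC]
  · intro C hC
    rcases Finset.mem_insert.1 hC with rfl | hC
    exacts [fun x hx => (mem_rest.1 (hTR hx)).1, h.subset C hC]
  · refine Finset.card_insert_of_notMem fun hm => ?_
    have := hd T hm
    rw [disjoint_self] at this
    exact hT.nonempty.ne_empty this

lemma erase (h : G.IsPacking S 𝒞) (C : Finset α) : G.IsPacking S (𝒞.erase C) where
  pairwiseDisjoint := h.pairwiseDisjoint.subset (by simp)
  isCore D hD := h.isCore D (Finset.mem_of_mem_erase hD)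
  subset D hD := h.subset D (Finset.mem_of_mem_erase hD)

lemma rest_erase (h : G.IsPacking S 𝒞) (hC : C ∈ 𝒞) :
    rest S (𝒞.erase C) = C ∪ rest S 𝒞 := by
  ext x
  simp only [mem_rest, Finset.mem_union, Finset.mem_erase]
  constructor
  · rintro ⟨hx, hn⟩
    by_cases hxC : x ∈ C
    · exact Or.inl hxC
    · refine Or.inr ⟨hx, fun D hD hxD => ?_⟩
      by_cases hDC : D = C
      · exact hxC (hDC ▸ hxD)
      · exact hn D ⟨hDC, hD⟩ hxD
  · rintro (hxC | ⟨hx, hn⟩)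
    · exact ⟨h.subset C hC hxC, fun D hD hxD => h.notMem hC hD.2 (Ne.symm hD.1) hxC hxD⟩
    · exact ⟨hx, fun D hD => hn D hD.2⟩

lemma replace (h : G.IsPacking S 𝒞) (hC : C ∈ 𝒞) (hT : G.IsCore T) (hTR : T ⊆ C ∪ rest S 𝒞) :
    G.IsPacking S (Insert.insert T (𝒞.erase C)) ∧
      (Insert.insert T (𝒞.erase C)).card = 𝒞.card := by
  rw [← h.rest_erase hC] at hTR
  obtain ⟨h1, h2⟩ := (h.erase C).insert hT hTR
  exact ⟨h1, h2.trans (Finset.card_erase_add_one hC)⟩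

end IsPacking

lemma rest_insert {𝒞 : Finset (Finset α)} : rest S (insert T 𝒞) = rest S 𝒞 \ T := by
  ext x
  simp only [mem_rest, Finset.mem_sdiff, Finset.forall_mem_insert]
  tauto

/-- A packing of `m` cores in a set `S` that has no packing of `m + 1` cores and has minimum degree
at least `2 * m + 2`, chosen with as many vertices as possible outside the cores, and then with as
many edges as possible between those. -/
structure IsExtremalPacking (G : SimpleGraph α) (S : Finset α) (m : ℕ) (𝒞 : Finset (Finset α)) :
    Prop where
  isPacking : G.IsPacking S 𝒞
  card_eq : 𝒞.card = m
  card_ne : ∀ 𝒟, G.IsPacking S 𝒟 → 𝒟.card ≠ m + 1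
  three_le : 3 ≤ (rest S 𝒞).card
  le_degIn : ∀ v ∈ S, 2 * m + 2 ≤ G.degIn S v
  best : ∀ 𝒟, G.IsPacking S 𝒟 → 𝒟.card = m → (rest S 𝒟).card < (rest S 𝒞).card ∨
    (rest S 𝒟).card = (rest S 𝒞).card ∧ G.degSum (rest S 𝒟) ≤ G.degSum (rest S 𝒞)

namespace IsExtremalPacking

variable {m : ℕ} {𝒞 : Finset (Finset α)} {C D : Finset α} {u v w x : α}

lemma not_isCore (h : G.IsExtremalPacking S m 𝒞) : ∀ T ⊆ rest S 𝒞, ¬ G.IsCore T := fun T hT hc => by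
  obtain ⟨h1, h2⟩ := h.isPacking.insert hc hT
  exact h.card_ne _ h1 (h2.trans (by rw [h.card_eq]))

lemma card_le_card (h : G.IsExtremalPacking S m 𝒞) (hC : C ∈ 𝒞) (hT : G.IsCore T)
    (hTR : T ⊆ C ∪ rest S 𝒞) : C.card ≤ T.card := by
  obtain ⟨h1, h2⟩ := h.isPacking.replace hC hT hTR
  have h3 := h.best _ h1 (h2.trans h.card_eq)
  rw [rest_insert, h.isPacking.rest_erase hC, Finset.card_sdiff_of_subset hTR,
    Finset.card_union_of_disjoint] at h3
  · omega
  · exact Finset.disjoint_right.2 fun x hx => (mem_rest.1 hx).2 C hC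

lemma card_eq_three (h : G.IsExtremalPacking S m 𝒞) (hC : C ∈ 𝒞) (hx : x ∈ rest S 𝒞)
    (hd : 3 ≤ G.degIn C x) : C.card = 3 := by
  have h3 := (h.isPacking.isCore C hC).three_le_card
  by_contra hne
  obtain ⟨U, hU, hc, hlt⟩ := (h.isPacking.isCore C hC).exists_smaller
    (fun U hU hc => (Finset.card_lt_card hU).not_ge
      (h.card_le_card hC hc (hU.subset.trans Finset.subset_union_left)))
    (by omega) ((mem_rest.1 hx).2 C hC) hd
  refine hlt.not_ge (h.card_le_card hC hc (hU.trans ?_))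
  exact Finset.insert_subset (Finset.mem_union_right _ hx) Finset.subset_union_left

lemma degIn_le_three (h : G.IsExtremalPacking S m 𝒞) (hC : C ∈ 𝒞) (hx : x ∈ rest S 𝒞) :
    G.degIn C x ≤ 3 := by
  by_contra! hd
  have h1 := h.card_eq_three hC hx (by omega)
  have h2 := degIn_le_card (G := G) (S := C) x
  omega

lemma sum_degIn (h : G.IsExtremalPacking S m 𝒞) (hx : x ∈ S) :
    2 * m + 2 ≤ G.degIn (rest S 𝒞) x + ∑ C ∈ 𝒞, G.degIn C x :=
  (h.le_degIn x hx).trans (h.isPacking.degIn_eq x).le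

lemma swap (h : G.IsExtremalPacking S m 𝒞) (hC : C ∈ 𝒞) (hC3 : C.card = 3) (hv : v ∈ rest S 𝒞)
    (hx : x ∈ C) (hvC : ∀ y ∈ C, y ≠ x → G.Adj v y) :
    G.degIn ((rest S 𝒞).erase v) x ≤ G.degIn (rest S 𝒞) v ∧
    (G.degIn ((rest S 𝒞).erase v) x = G.degIn (rest S 𝒞) v →
      ∃ 𝒟, G.IsExtremalPacking S m 𝒟 ∧ 𝒞.erase C ⊆ 𝒟 ∧
        rest S 𝒟 = insert x ((rest S 𝒞).erase v)) := by
  obtain ⟨hvS, hvn⟩ := mem_rest.1 hv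
  have hcore : G.IsCore (insert v (C.erase x)) := by
    obtain ⟨y, z, hyz, he⟩ := Finset.card_eq_two.1
      (show (C.erase x).card = 2 by rw [Finset.card_erase_of_mem hx, hC3])
    have hy : y ∈ C.erase x := by simp [he]
    have hz : z ∈ C.erase x := by simp [he]
    rw [Finset.mem_erase] at hy hz
    rw [he]
    exact isCore_triple (hvC y hy.2 hy.1) (hvC z hz.2 hz.1)
      ((h.isPacking.isCore C hC).adj_of_card_eq_three hC3 hy.2 hz.2 hyz)
  have hsub : insert v (C.erase x) ⊆ C ∪ rest S 𝒞 :=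
    Finset.insert_subset (Finset.mem_union_right _ hv)
      ((Finset.erase_subset _ _).trans Finset.subset_union_left)
  obtain ⟨h1, h2⟩ := h.isPacking.replace hC hcore hsub
  have h3 := h.best _ h1 (h2.trans h.card_eq)
  have hxR : x ∉ rest S 𝒞 := fun hxR => (mem_rest.1 hxR).2 C hC hx
  have hrest : rest S (insert (insert v (C.erase x)) (𝒞.erase C)) =
      insert x ((rest S 𝒞).erase v) := by
    rw [rest_insert, h.isPacking.rest_erase hC]
    ext y
    simp only [Finset.mem_sdiff, Finset.mem_union, Finset.mem_insert, Finset.mem_erase]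
    have hyC : y ∈ rest S 𝒞 → y ∉ C := fun hy => (mem_rest.1 hy).2 C hC
    have hvC : v ∉ C := hvn C hC
    by_cases hyx : y = x
    · subst hyx
      simp only [hx, ne_eq, not_true, or_false, true_or, and_true, true_and, iff_true]
      rintro rfl
      exact hvn C hC hx
    · tauto
  have hcard : (rest S (insert (insert v (C.erase x)) (𝒞.erase C))).card = (rest S 𝒞).card := by
    rw [hrest, Finset.card_insert_of_notMem (by simp [hxR]), Finset.card_erase_add_one hv]
  have hsum : G.degSum (rest S (insert (insert v (C.erase x)) (𝒞.erase C))) +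
      2 * G.degIn (rest S 𝒞) v =
      G.degSum (rest S 𝒞) + 2 * G.degIn ((rest S 𝒞).erase v) x := by
    rw [hrest, degSum_insert (by simp [hxR]), degSum_erase hv]
    ring
  refine ⟨by omega, fun heq => ⟨_, ⟨h1, h2.trans h.card_eq, h.card_ne, ?_, h.le_degIn, ?_⟩,
    Finset.subset_insert _ _, hrest⟩⟩
  · rw [hcard]
    exact h.three_le
  · intro 𝒟 h𝒟 hm
    have := h.best 𝒟 h𝒟 hm
    omega

lemma exists_lt_of_mul_lt_sum {𝒟 : Finset (Finset α)} {f : Finset α → ℕ} {N : ℕ}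
    (h : N * 𝒟.card < ∑ C ∈ 𝒟, f C) : ∃ C ∈ 𝒟, N < f C := by
  by_contra! hf
  refine h.not_ge ((Finset.sum_le_card_nsmul 𝒟 f N hf).trans ?_)
  rw [smul_eq_mul, mul_comm]

/-- No vertex outside the cores of an extremal packing is isolated there. -/
lemma one_le_degIn (h : G.IsExtremalPacking S m 𝒞) (hv : v ∈ rest S 𝒞) : 1 ≤ G.degIn (rest S 𝒞) v := by
  by_contra! h0
  have h0 : G.degIn (rest S 𝒞) v = 0 := by omega
  obtain ⟨u, hu, hu1⟩ := exists_degIn_le_one (G := G) (S := (rest S 𝒞).erase v)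
    (by
      have := h.three_le
      rw [← Finset.card_pos, Finset.card_erase_of_mem hv]
      omega)
    fun T hT => h.not_isCore T (hT.trans (Finset.erase_subset _ _))
  obtain ⟨huv, hu⟩ := Finset.mem_erase.1 hu
  have huv' : ¬ G.Adj u v := fun ha => degIn_eq_zero_iff.1 h0 u hu ha.symm
  have hu2 := degIn_erase (G := G) hv u
  rw [if_neg huv'] at hu2
  have s1 := h.sum_degIn (mem_rest.1 hu).1
  have s2 := h.sum_degIn (mem_rest.1 hv).1
  obtain ⟨C, hC, hlt⟩ := exists_lt_of_mul_lt_sum (𝒟 := 𝒞)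
    (f := fun C => G.degIn C u + G.degIn C v) (N := 4) (by
      rw [Finset.sum_add_distrib, h.card_eq]
      omega)
  have hC3 : C.card = 3 := by
    by_cases h3 : 3 ≤ G.degIn C u
    · exact h.card_eq_three hC hu h3
    · exact h.card_eq_three hC hv (by omega)
  obtain ⟨x, hx, hux, hvx⟩ := exists_adj_and_forall_adj hC3 hlt
  have := (h.swap hC hC3 hv hx hvx).1
  have : 0 < G.degIn ((rest S 𝒞).erase v) x :=
    degIn_pos_iff.2 ⟨u, Finset.mem_erase.2 ⟨huv, hu⟩, hux.symm⟩
  omega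

lemma not_adj_adj_of_forall_adj (h : G.IsExtremalPacking S m 𝒞) (hC : C ∈ 𝒞) (hC3 : C.card = 3)
    (hv : v ∈ rest S 𝒞) (hv1 : G.degIn (rest S 𝒞) v = 1) (hx : x ∈ C)
    (hvC : ∀ y ∈ C, y ≠ x → G.Adj v y) (hu : u ∈ rest S 𝒞) (hw : w ∈ rest S 𝒞) (huv : u ≠ v)
    (hwv : w ≠ v) (huw : u ≠ w) (hux : G.Adj u x) (hwx : G.Adj w x) : False := by
  have h1 := (h.swap hC hC3 hv hx hvC).1
  have h2 : 2 ≤ G.degIn ((rest S 𝒞).erase v) x :=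
    two_le_degIn (Finset.mem_erase.2 ⟨huv, hu⟩) (Finset.mem_erase.2 ⟨hwv, hw⟩) huw hux.symm
      hwx.symm
  omega

/-- The vertices outside the cores of an extremal packing include no three leaves. -/
lemma not_three_leaves (h : G.IsExtremalPacking S m 𝒞) (hu : u ∈ rest S 𝒞) (hv : v ∈ rest S 𝒞)
    (hw : w ∈ rest S 𝒞) (huv : u ≠ v) (huw : u ≠ w) (hvw : v ≠ w)
    (hu1 : G.degIn (rest S 𝒞) u = 1) (hv1 : G.degIn (rest S 𝒞) v = 1)
    (hw1 : G.degIn (rest S 𝒞) w = 1) : False := by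
  have s1 := h.sum_degIn (mem_rest.1 hu).1
  have s2 := h.sum_degIn (mem_rest.1 hv).1
  have s3 := h.sum_degIn (mem_rest.1 hw).1
  obtain ⟨C, hC, hlt⟩ := exists_lt_of_mul_lt_sum (𝒟 := 𝒞)
    (f := fun C => G.degIn C u + G.degIn C v + G.degIn C w) (N := 6) (by
      rw [Finset.sum_add_distrib, Finset.sum_add_distrib, h.card_eq]
      omega)
  have hC3 : C.card = 3 := by
    by_cases h3 : 3 ≤ G.degIn C u
    · exact h.card_eq_three hC hu h3
    by_cases h4 : 3 ≤ G.degIn C v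
    · exact h.card_eq_three hC hv h4
    · exact h.card_eq_three hC hw (by omega)
  obtain ⟨x, hx, ⟨hux, hvx, hwx⟩ | ⟨hux, hwx, hvx⟩ | ⟨hvx, hwx, hux⟩⟩ :=
    exists_adj_adj_and_forall_adj hC3 hlt
  · exact h.not_adj_adj_of_forall_adj hC hC3 hw hw1 hx hwx hu hv huw hvw huv hux hvx
  · exact h.not_adj_adj_of_forall_adj hC hC3 hv hv1 hx hvx hu hw huv hvw.symm huw hux hwx
  · exact h.not_adj_adj_of_forall_adj hC hC3 hu hu1 hx hux hv hw huv.symm huw.symm hvw hvx hwx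

end IsExtremalPacking

/-- `u` and `v` are the ends of `R`, a set all of whose other vertices have degree two. -/
structure IsEnds (G : SimpleGraph α) (R : Finset α) (u v : α) : Prop where
  left_mem : u ∈ R
  right_mem : v ∈ R
  ne : u ≠ v
  left_eq : G.degIn R u = 1
  right_eq : G.degIn R v = 1
  eq_two : ∀ w ∈ R, w ≠ u → w ≠ v → G.degIn R w = 2

lemma IsEnds.symm {R : Finset α} {u v : α} (h : G.IsEnds R u v) : G.IsEnds R v u :=
  ⟨h.right_mem, h.left_mem, h.ne.symm, h.right_eq, h.left_eq, fun w hw h1 h2 => h.eq_two w hw h2 h1⟩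

namespace IsExtremalPacking

variable {m : ℕ} {𝒞 : Finset (Finset α)} {C D : Finset α} {u v w x : α}

lemma isEnds_of_degIn_eq_one (h : G.IsExtremalPacking S m 𝒞) (hu : u ∈ rest S 𝒞) (hv : v ∈ rest S 𝒞)
    (huv : u ≠ v) (hu1 : G.degIn (rest S 𝒞) u = 1) (hv1 : G.degIn (rest S 𝒞) v = 1) :
    G.IsEnds (rest S 𝒞) u v := by
  refine ⟨hu, hv, huv, hu1, hv1, ?_⟩
  have h2 : ∀ w ∈ ((rest S 𝒞).erase u).erase v, 2 ≤ G.degIn (rest S 𝒞) w := by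
    intro w hw
    simp only [Finset.mem_erase] at hw
    have := h.one_le_degIn hw.2.2
    by_contra! hlt
    exact h.not_three_leaves hu hv hw.2.2 huv hw.2.1.symm hw.1.symm hu1 hv1 (by omega)
  have h3 := degSum_add_two_le (Finset.card_pos.1 (by have := h.three_le; omega)) h.not_isCore
  have hv' : v ∈ (rest S 𝒞).erase u := Finset.mem_erase.2 ⟨huv.symm, hv⟩
  have e1 := Finset.card_erase_add_one hu
  have e2 := Finset.card_erase_add_one hv'
  rw [degSum, ← Finset.add_sum_erase _ _ hu, ← Finset.add_sum_erase _ _ hv', hu1, hv1] at h3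
  have h4 := (Finset.sum_eq_sum_iff_of_le h2).1 (le_antisymm (Finset.sum_le_sum h2) (by
    rw [Finset.sum_const, smul_eq_mul]
    omega))
  intro w hw hwu hwv
  exact (h4 w (by simp [*])).symm

lemma exists_isEnds (h : G.IsExtremalPacking S m 𝒞) : ∃ u v, G.IsEnds (rest S 𝒞) u v := by
  have h3 := h.three_le
  have hne : (rest S 𝒞).Nonempty := Finset.card_pos.1 (by omega)
  obtain ⟨u, hu, hu1⟩ := exists_degIn_le_one hne h.not_isCore
  have hu2 := h.one_le_degIn hu
  obtain ⟨v, hv, hv1⟩ : ∃ v ∈ (rest S 𝒞).erase u, G.degIn (rest S 𝒞) v ≤ 1 := by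
    by_contra! hlt
    have h4 := degSum_add_two_le hne h.not_isCore
    rw [degSum, ← Finset.add_sum_erase _ _ hu] at h4
    have h5 : ((rest S 𝒞).erase u).card • 2 ≤
        ∑ w ∈ (rest S 𝒞).erase u, G.degIn (rest S 𝒞) w := Finset.card_nsmul_le_sum _ _ 2 hlt
    have e1 := Finset.card_erase_add_one hu
    rw [smul_eq_mul] at h5
    omega
  obtain ⟨hvu, hv⟩ := Finset.mem_erase.1 hv
  have hv2 := h.one_le_degIn hv
  exact ⟨u, v, h.isEnds_of_degIn_eq_one hu hv hvu.symm (by omega) (by omega)⟩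

lemma not_adj_ends (h : G.IsExtremalPacking S m 𝒞) (he : G.IsEnds (rest S 𝒞) u v) : ¬ G.Adj u v := by
  intro ha
  have h3 := h.three_le
  have hv' : v ∈ (rest S 𝒞).erase u := Finset.mem_erase.2 ⟨he.ne.symm, he.right_mem⟩
  have e1 := Finset.card_erase_add_one he.left_mem
  have e2 := Finset.card_erase_add_one hv'
  refine h.not_isCore (((rest S 𝒞).erase u).erase v)
    ((Finset.erase_subset _ _).trans (Finset.erase_subset _ _))
    ⟨Finset.card_pos.1 (by omega), fun w hw => ?_⟩
  simp only [Finset.mem_erase] at hw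
  have h1 := he.eq_two w hw.2.2 hw.2.1 hw.1
  have hwu : ¬ G.Adj w u := fun hwu => by
    have := two_le_degIn hw.2.2 he.right_mem hw.1 hwu.symm ha
    have := he.left_eq
    omega
  have hwv : ¬ G.Adj w v := fun hwv => by
    have := two_le_degIn hw.2.2 he.left_mem hw.2.1 hwv.symm ha.symm
    have := he.right_eq
    omega
  rw [degIn_erase he.left_mem, if_neg hwu, degIn_erase hv', if_neg hwv] at h1
  omega

lemma card_eq_three_of_five_le (h : G.IsExtremalPacking S m 𝒞) (hC : C ∈ 𝒞) (hu : u ∈ rest S 𝒞)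
    (hv : v ∈ rest S 𝒞) (h5 : 5 ≤ G.degIn C u + G.degIn C v) : C.card = 3 := by
  by_cases h3 : 3 ≤ G.degIn C u
  · exact h.card_eq_three hC hu h3
  · exact h.card_eq_three hC hv (by omega)

/-- If the ends together have five neighbours on a core, then the other vertices outside the cores
have none. -/
lemma degIn_eq_zero (h : G.IsExtremalPacking S m 𝒞) (he : G.IsEnds (rest S 𝒞) u v) (hC : C ∈ 𝒞)
    (h5 : 5 ≤ G.degIn C u + G.degIn C v) (hw : w ∈ rest S 𝒞) (hwu : w ≠ u) (hwv : w ≠ v) :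
    G.degIn C w = 0 := by
  have hC3 := h.card_eq_three_of_five_le hC he.left_mem he.right_mem h5
  refine degIn_eq_zero_iff.2 fun x hx hwx => ?_
  by_cases hvx : (∀ y ∈ C, y ≠ x → G.Adj v y) ∧ G.Adj u x
  · exact h.not_adj_adj_of_forall_adj hC hC3 he.right_mem he.right_eq hx hvx.1 hw he.left_mem
      hwv he.ne hwu hwx hvx.2
  by_cases hux : (∀ y ∈ C, y ≠ x → G.Adj u y) ∧ G.Adj v x
  · exact h.not_adj_adj_of_forall_adj hC hC3 he.left_mem he.left_eq hx hux.1 hw he.right_mem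
      hwu he.ne.symm hwv hwx hux.2
  clear hwx he
  obtain ⟨a, b, c, hab, hac, hbc, rfl⟩ := Finset.card_eq_three.1 hC3
  rw [degIn_triple hab hac hbc, degIn_triple hab hac hbc] at h5
  simp only [Finset.mem_insert, Finset.mem_singleton] at hx hux hvx
  grind

end IsExtremalPacking

lemma IsEnds.exists_adj {R : Finset α} {u v : α} (h : G.IsEnds R u v) (huv : ¬ G.Adj u v) :
    ∃ p ∈ R, G.Adj u p ∧ p ≠ u ∧ p ≠ v ∧ G.degIn R p = 2 := by
  obtain ⟨p, hp, hup⟩ := degIn_pos_iff.1 (show 0 < G.degIn R u by rw [h.left_eq]; omega)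
  have hpv : p ≠ v := fun e => huv (e ▸ hup)
  exact ⟨p, hp, hup, hup.ne', hpv, h.eq_two p hp hup.ne' hpv⟩

namespace IsExtremalPacking

variable {m : ℕ} {𝒞 : Finset (Finset α)} {C D : Finset α} {u v w x b p : α}

lemma degIn_core_eq_two (h : G.IsExtremalPacking S m 𝒞) (hC : C ∈ 𝒞) (hC3 : C.card = 3)
    (hx : x ∈ C) : G.degIn C x = 2 := by
  have h1 := (h.isPacking.isCore C hC).two_le x hx
  have h2 := degIn_lt_card (G := G) hx
  omega

lemma degIn_rest_eq_two (h : G.IsExtremalPacking S m 𝒞) (he : G.IsEnds (rest S 𝒞) u v)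
    (hC : C ∈ 𝒞) (h5 : 5 ≤ G.degIn C u + G.degIn C v) (hx : x ∈ C) (hu : G.Adj u x)
    (hv : G.Adj v x) : G.degIn (rest S 𝒞) x = 2 := by
  have hv' : v ∈ (rest S 𝒞).erase u := Finset.mem_erase.2 ⟨he.ne.symm, he.right_mem⟩
  rw [degIn_erase he.left_mem, degIn_erase hv', if_pos hu.symm, if_pos hv.symm]
  suffices G.degIn (((rest S 𝒞).erase u).erase v) x = 0 by omega
  refine degIn_eq_zero_iff.2 fun w hw hxw => ?_
  simp only [Finset.mem_erase] at hw
  exact degIn_eq_zero_iff.1 (h.degIn_eq_zero he hC h5 hw.2.2 hw.2.1 hw.1) x hx hxw.symm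

/-- Exchanging an end `u` with a vertex `b` of a triangle that is joined to the other end. -/
lemma exists_swap (h : G.IsExtremalPacking S m 𝒞) (he : G.IsEnds (rest S 𝒞) u v) (hC : C ∈ 𝒞)
    (h5 : 5 ≤ G.degIn C u + G.degIn C v) (hu3 : G.degIn C u = 3) (hb : b ∈ C) (hvb : G.Adj v b)
    (hp : p ∈ rest S 𝒞) (hup : G.Adj u p) (hpv : p ≠ v) :
    ∃ 𝒟, G.IsExtremalPacking S m 𝒟 ∧ 𝒞.erase C ⊆ 𝒟 ∧ G.IsEnds (rest S 𝒟) b p ∧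
      rest S 𝒟 = insert b ((rest S 𝒞).erase u) := by
  have hC3 := h.card_eq_three_of_five_le hC he.left_mem he.right_mem h5
  have hadj : ∀ y ∈ C, G.Adj u y := fun y hy => adj_of_degIn_eq_card (by omega) hy
  have hb2 := h.degIn_rest_eq_two he hC h5 hb (hadj b hb) hvb
  rw [degIn_erase he.left_mem, if_pos (hadj b hb).symm] at hb2
  obtain ⟨𝒟, h1, h2, h3⟩ := (h.swap hC hC3 he.left_mem hb fun y hy _ => hadj y hy).2
    (by rw [he.left_eq]; omega)
  have hbR : b ∉ (rest S 𝒞).erase u := fun hbR =>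
    (mem_rest.1 (Finset.mem_of_mem_erase hbR)).2 C hC hb
  have hpR : p ∈ (rest S 𝒞).erase u := Finset.mem_erase.2 ⟨hup.ne', hp⟩
  have hp0 := degIn_eq_zero_iff.1 (h.degIn_eq_zero he hC h5 hp hup.ne' hpv) b hb
  have hp2 := he.eq_two p hp hup.ne' hpv
  rw [degIn_erase he.left_mem, if_pos hup.symm] at hp2
  refine ⟨𝒟, h1, h2, h1.isEnds_of_degIn_eq_one ?_ ?_ ?_ ?_ ?_, h3⟩
  · rw [h3]; exact Finset.mem_insert_self _ _
  · rw [h3]; exact Finset.mem_insert_of_mem hpR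
  · rintro rfl; exact hbR hpR
  · rw [h3, degIn_insert hbR, if_neg (G.irrefl)]; omega
  · rw [h3, degIn_insert hbR, if_neg hp0]; omega

/-- After the exchange, five neighbours of the new ends on another core exclude neighbours of the
other vertices there. -/
lemma degIn_eq_zero_of_swap (h : G.IsExtremalPacking S m 𝒞) (he : G.IsEnds (rest S 𝒞) u v)
    (hC : C ∈ 𝒞) (h5 : 5 ≤ G.degIn C u + G.degIn C v) (hu3 : G.degIn C u = 3) (hb : b ∈ C)
    (hvb : G.Adj v b) (hp : p ∈ rest S 𝒞) (hup : G.Adj u p) (hpv : p ≠ v) (hT : T ∈ 𝒞.erase C) :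
    G.degIn T b ≤ 3 ∧
    (5 ≤ G.degIn T p + G.degIn T b →
      ∀ w ∈ rest S 𝒞, w ≠ u → w ≠ p → G.degIn T w = 0) := by
  obtain ⟨𝒟, h1, h2, h3, h4⟩ := h.exists_swap he hC h5 hu3 hb hvb hp hup hpv
  refine ⟨h1.degIn_le_three (h2 hT) h3.left_mem, fun hd w hw hwu hwp => ?_⟩
  · refine h1.degIn_eq_zero h3 (h2 hT) (by omega) ?_ ?_ hwp
    · rw [h4]
      exact Finset.mem_insert_of_mem (Finset.mem_erase.2 ⟨hwu, hw⟩)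
    · rintro rfl
      exact (mem_rest.1 hw).2 C hC hb

lemma sum_degIn_erase (h : G.IsExtremalPacking S m 𝒞) (hC : C ∈ 𝒞) (hx : x ∈ S) :
    2 * (𝒞.erase C).card + 4 ≤
      G.degIn (rest S 𝒞) x + G.degIn C x + ∑ T ∈ 𝒞.erase C, G.degIn T x := by
  have h1 := h.sum_degIn hx
  rw [← Finset.add_sum_erase _ _ hC] at h1
  have h2 := Finset.card_erase_add_one hC
  have h3 := h.card_eq
  omega

lemma exists_five_le (h : G.IsExtremalPacking S m 𝒞) (he : G.IsEnds (rest S 𝒞) u v) :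
    ∃ C ∈ 𝒞, 5 ≤ G.degIn C u + G.degIn C v := by
  have s1 := h.sum_degIn (mem_rest.1 he.left_mem).1
  have s2 := h.sum_degIn (mem_rest.1 he.right_mem).1
  rw [he.left_eq] at s1
  rw [he.right_eq] at s2
  exact exists_lt_of_mul_lt_sum (𝒟 := 𝒞) (f := fun C => G.degIn C u + G.degIn C v) (N := 4) (by
      rw [Finset.sum_add_distrib, h.card_eq]
      omega)

/-- The two ends are not both joined to all vertices of a core. -/
lemma not_six_le (h : G.IsExtremalPacking S m 𝒞) (he : G.IsEnds (rest S 𝒞) u v) (hC : C ∈ 𝒞) :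
    ¬ 6 ≤ G.degIn C u + G.degIn C v := by
  intro h6
  have hu3 := h.degIn_le_three hC he.left_mem
  have hv3 := h.degIn_le_three hC he.right_mem
  have hC3 := h.card_eq_three_of_five_le hC he.left_mem he.right_mem (by omega)
  have hua : ∀ y ∈ C, G.Adj u y := fun y hy => adj_of_degIn_eq_card (by omega) hy
  have hva : ∀ y ∈ C, G.Adj v y := fun y hy => adj_of_degIn_eq_card (by omega) hy
  obtain ⟨p, hp, hup, hpu, hpv, hp2⟩ := he.exists_adj (h.not_adj_ends he)
  obtain ⟨q, hq, hvq, hqv, hqu, hq2⟩ := he.symm.exists_adj (h.not_adj_ends he.symm)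
  obtain ⟨b, hb, c, hc, hbc⟩ := Finset.one_lt_card.1 (show 1 < C.card by omega)
  have hp0 := h.degIn_eq_zero he hC (by omega) hp hpu hpv
  have hq0 := h.degIn_eq_zero he hC (by omega) hq hqu hqv
  have sp := h.sum_degIn_erase hC (mem_rest.1 hp).1
  have sq := h.sum_degIn_erase hC (mem_rest.1 hq).1
  have su := h.sum_degIn_erase hC (mem_rest.1 he.left_mem).1
  have sv := h.sum_degIn_erase hC (mem_rest.1 he.right_mem).1
  have sb := h.sum_degIn_erase hC (h.isPacking.subset C hC hb)
  have sc := h.sum_degIn_erase hC (h.isPacking.subset C hC hc)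
  rw [h.degIn_rest_eq_two he hC (by omega) hb (hua b hb) (hva b hb),
    h.degIn_core_eq_two hC hC3 hb] at sb
  rw [h.degIn_rest_eq_two he hC (by omega) hc (hua c hc) (hva c hc),
    h.degIn_core_eq_two hC hC3 hc] at sc
  rw [he.left_eq] at su
  rw [he.right_eq] at sv
  obtain ⟨T, hT, hlt⟩ := exists_lt_of_mul_lt_sum (𝒟 := 𝒞.erase C) (N := 12)
    (f := fun T => G.degIn T p + G.degIn T q + G.degIn T b + G.degIn T c + G.degIn T u +
      G.degIn T v) (by
      simp only [Finset.sum_add_distrib]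
      omega)
  have hT' := Finset.mem_of_mem_erase hT
  have eu := h.degIn_le_three hT' he.left_mem
  have ev := h.degIn_le_three hT' he.right_mem
  have ep := h.degIn_le_three hT' hp
  have eq := h.degIn_le_three hT' hq
  obtain ⟨eb, hpb⟩ := h.degIn_eq_zero_of_swap he hC (by omega) (by omega) hb (hva b hb) hp hup
    hpv hT
  obtain ⟨ec, hpc⟩ := h.degIn_eq_zero_of_swap he hC (by omega) (by omega) hc (hva c hc) hp hup
    hpv hT
  obtain ⟨-, hqb⟩ := h.degIn_eq_zero_of_swap he.symm hC (by omega) (by omega) hb (hua b hb) hq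
    hvq hqu hT
  obtain ⟨-, hqc⟩ := h.degIn_eq_zero_of_swap he.symm hC (by omega) (by omega) hc (hua c hc) hq
    hvq hqu hT
  have hpv' : 5 ≤ G.degIn T p + G.degIn T b ∨ 5 ≤ G.degIn T p + G.degIn T c →
      G.degIn T v = 0 ∧ (q ≠ p → G.degIn T q = 0) := by
    rintro (h5 | h5)
    · exact ⟨hpb h5 v he.right_mem he.ne.symm hpv.symm, hpb h5 q hq hqu⟩
    · exact ⟨hpc h5 v he.right_mem he.ne.symm hpv.symm, hpc h5 q hq hqu⟩
  have hqu' : 5 ≤ G.degIn T q + G.degIn T b ∨ 5 ≤ G.degIn T q + G.degIn T c →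
      G.degIn T u = 0 ∧ (p ≠ q → G.degIn T p = 0) := by
    rintro (h5 | h5)
    · exact ⟨hqb h5 u he.left_mem he.ne hqu.symm, hqb h5 p hp hpv⟩
    · exact ⟨hqc h5 u he.left_mem he.ne hqu.symm, hqc h5 p hp hpv⟩
  have huv0 : 5 ≤ G.degIn T u + G.degIn T v → G.degIn T p = 0 ∧ G.degIn T q = 0 := fun h5 =>
    ⟨h.degIn_eq_zero he hT' h5 hp hpu hpv, h.degIn_eq_zero he hT' h5 hq hqu hqv⟩
  clear hpb hpc hqb hqc sp sq su sv sb sc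
  by_cases hpq : p = q
  · subst hpq
    omega
  · simp only [hpq, Ne.symm hpq, ne_eq, not_false_eq_true, true_implies] at hpv' hqu'
    omega

/-- There are no extremal packings. -/
theorem false (h : G.IsExtremalPacking S m 𝒞) : False := by
  suffices ∀ u v C, G.IsEnds (rest S 𝒞) u v → C ∈ 𝒞 → 5 ≤ G.degIn C u + G.degIn C v →
      ¬ G.degIn C v ≤ G.degIn C u by
    obtain ⟨u, v, he⟩ := h.exists_isEnds
    obtain ⟨C, hC, h5⟩ := h.exists_five_le he
    rcases le_total (G.degIn C v) (G.degIn C u) with hle | hle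
    · exact this u v C he hC h5 hle
    · exact this v u C he.symm hC (by omega) hle
  intro u v C he hC h5 hle
  have h6 := h.not_six_le he hC
  have hu3 := h.degIn_le_three hC he.left_mem
  have hC3 := h.card_eq_three_of_five_le hC he.left_mem he.right_mem h5
  have hua : ∀ y ∈ C, G.Adj u y := fun y hy => adj_of_degIn_eq_card (by omega) hy
  obtain ⟨p, hp, hup, hpu, hpv, hp2⟩ := he.exists_adj (h.not_adj_ends he)
  obtain ⟨b, hb, c, hc, hbc⟩ := Finset.one_lt_card.1
    (show 1 < (C.filter (G.Adj v)).card from show 1 < G.degIn C v by omega)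
  obtain ⟨hb, hvb⟩ := Finset.mem_filter.1 hb
  obtain ⟨hc, hvc⟩ := Finset.mem_filter.1 hc
  have hp0 := h.degIn_eq_zero he hC h5 hp hpu hpv
  have sp := h.sum_degIn_erase hC (mem_rest.1 hp).1
  have su := h.sum_degIn_erase hC (mem_rest.1 he.left_mem).1
  have sv := h.sum_degIn_erase hC (mem_rest.1 he.right_mem).1
  have sb := h.sum_degIn_erase hC (h.isPacking.subset C hC hb)
  have sc := h.sum_degIn_erase hC (h.isPacking.subset C hC hc)
  rw [h.degIn_rest_eq_two he hC h5 hb (hua b hb) hvb, h.degIn_core_eq_two hC hC3 hb] at sb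
  rw [h.degIn_rest_eq_two he hC h5 hc (hua c hc) hvc, h.degIn_core_eq_two hC hC3 hc] at sc
  rw [he.left_eq] at su
  rw [he.right_eq] at sv
  obtain ⟨T, hT, hlt⟩ := exists_lt_of_mul_lt_sum (𝒟 := 𝒞.erase C) (N := 16)
    (f := fun T => 2 * G.degIn T p + G.degIn T b + G.degIn T c + 2 * G.degIn T u +
      2 * G.degIn T v) (by
      simp only [Finset.sum_add_distrib, ← Finset.mul_sum]
      omega)
  have hT' := Finset.mem_of_mem_erase hT
  have eu := h.degIn_le_three hT' he.left_mem
  have ev := h.degIn_le_three hT' he.right_mem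
  have ep := h.degIn_le_three hT' hp
  have euv := h.not_six_le he hT'
  have huv0 : 5 ≤ G.degIn T u + G.degIn T v → G.degIn T p = 0 := fun h5 =>
    h.degIn_eq_zero he hT' h5 hp hpu hpv
  have key : ∀ x ∈ C, G.Adj v x → G.degIn T x ≤ 3 ∧ G.degIn T x + G.degIn T p < 6 ∧
      (5 ≤ G.degIn T p + G.degIn T x → G.degIn T v = 0) := by
    intro x hx hvx
    obtain ⟨ex, hpx⟩ := h.degIn_eq_zero_of_swap he hC h5 (by omega) hx hvx hp hup hpv hT
    obtain ⟨𝒟, h1, h2, h3, -⟩ := h.exists_swap he hC h5 (by omega) hx hvx hp hup hpv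
    exact ⟨ex, not_le.1 (h1.not_six_le h3 (h2 hT)),
      fun hd => hpx hd v he.right_mem he.ne.symm hpv.symm⟩
  obtain ⟨b1, b2, b3⟩ := key b hb hvb
  obtain ⟨c1, c2, c3⟩ := key c hc hvc
  clear key sp su sv sb sc
  omega

end IsExtremalPacking

lemma degIn_le_degIn {H : SimpleGraph α} {v : α} (h : ∀ w ∈ S, G.Adj v w → H.Adj v w) :
    G.degIn S v ≤ H.degIn S v :=
  Finset.card_le_card (Finset.monotone_filter_right _ h)

lemma card_nonadj_lt {H : SimpleGraph α} (hle : G ≤ H) {x y : α} (hx : x ∈ S) (hy : y ∈ S)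
    (hxy : x ≠ y) (hG : ¬ G.Adj x y) (hH : H.Adj x y) :
    ((S ×ˢ S).filter fun p => p.1 ≠ p.2 ∧ ¬ H.Adj p.1 p.2).card <
      ((S ×ˢ S).filter fun p => p.1 ≠ p.2 ∧ ¬ G.Adj p.1 p.2).card := by
  refine Finset.card_lt_card (Finset.ssubset_iff_of_subset ?_ |>.2 ⟨(x, y), ?_, ?_⟩)
  · exact Finset.monotone_filter_right _ fun p _ hp => ⟨hp.1, fun h => hp.2 (hle h)⟩
  · simp [hx, hy, hxy, hG]
  · simp [hH]

lemma IsPacking.sup_edge {x y : α} {m : ℕ} {𝒟 : Finset (Finset α)}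
    (h : (G ⊔ SimpleGraph.edge x y).IsPacking S 𝒟) (hcard : 𝒟.card = m + 1)
    (hG : ∀ 𝒞, G.IsPacking S 𝒞 → 𝒞.card ≠ m + 1) :
    ∃ 𝒞, G.IsPacking S 𝒞 ∧ 𝒞.card = m ∧ 3 ≤ (rest S 𝒞).card := by
  have key : ∀ C ∈ 𝒟, (x ∉ C ∨ y ∉ C) → G.IsCore C := by
    refine fun C hC hxy => ⟨(h.isCore C hC).nonempty, fun v hv => ?_⟩
    refine ((h.isCore C hC).two_le v hv).trans (degIn_le_degIn fun w hw ha => ?_)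
    rcases ha with ha | ha
    · exact ha
    · rw [edge_adj] at ha
      rcases ha with ⟨⟨rfl, rfl⟩ | ⟨rfl, rfl⟩, -⟩ <;> tauto
  obtain ⟨C, hC, hCG⟩ : ∃ C ∈ 𝒟, ¬ G.IsCore C := by
    by_contra! hall
    exact hG 𝒟 ⟨h.pairwiseDisjoint, hall, h.subset⟩ hcard
  have hxC : x ∈ C := by
    by_contra hx
    exact hCG (key C hC (Or.inl hx))
  refine ⟨𝒟.erase C, ⟨(h.erase C).pairwiseDisjoint, fun D hD => ?_, (h.erase C).subset⟩, ?_, ?_⟩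
  · obtain ⟨hDC, hD⟩ := Finset.mem_erase.1 hD
    exact key D hD (Or.inl (h.notMem hC hD hDC.symm hxC))
  · rw [Finset.card_erase_of_mem hC, hcard, Nat.add_sub_cancel]
  · rw [h.rest_erase hC]
    exact (h.isCore C hC).three_le_card.trans (Finset.card_le_card Finset.subset_union_left)

lemma exists_isPacking_of_complete (hS : ∀ x ∈ S, ∀ y ∈ S, x ≠ y → G.Adj x y) {k : ℕ}
    (hk : 3 * k ≤ S.card) :
    ∃ 𝒞, G.IsPacking S 𝒞 ∧ 𝒞.card = k ∧ ∀ C ∈ 𝒞, C.card = 3 := by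
  induction k with
  | zero => exact ⟨∅, ⟨by simp, by simp, by simp⟩, by simp, by simp⟩
  | succ k ih =>
    obtain ⟨𝒞, h𝒞, hc, h3⟩ := ih (by omega)
    have h1 := h𝒞.card_rest_add
    rw [Finset.sum_congr rfl h3, Finset.sum_const, smul_eq_mul, hc] at h1
    obtain ⟨T, hT, hT3⟩ := Finset.exists_subset_card_eq (show 3 ≤ (rest S 𝒞).card by omega)
    have hcore : G.IsCore T := by
      obtain ⟨a, b, c, hab, hac, hbc, rfl⟩ := Finset.card_eq_three.1 hT3
      have hm : ∀ x ∈ ({a, b, c} : Finset α), x ∈ S := fun x hx => (mem_rest.1 (hT hx)).1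
      exact isCore_triple (hS a (hm a (by simp)) b (hm b (by simp)) hab)
        (hS a (hm a (by simp)) c (hm c (by simp)) hac)
        (hS b (hm b (by simp)) c (hm c (by simp)) hbc)
    obtain ⟨h4, h5⟩ := h𝒞.insert hcore hT
    refine ⟨_, h4, h5.trans (by rw [hc]), fun C hC => ?_⟩
    rcases Finset.mem_insert.1 hC with rfl | hC
    exacts [hT3, h3 C hC]

lemma exists_isExtremalPacking {m : ℕ} {𝒞 : Finset (Finset α)} (h : G.IsPacking S 𝒞)
    (hm : 𝒞.card = m) (h3 : 3 ≤ (rest S 𝒞).card) (hG : ∀ 𝒟, G.IsPacking S 𝒟 → 𝒟.card ≠ m + 1)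
    (hd : ∀ v ∈ S, 2 * m + 2 ≤ G.degIn S v) : ∃ 𝒟, G.IsExtremalPacking S m 𝒟 := by
  obtain ⟨𝒟, h𝒟, hmax⟩ := Finset.exists_max_image
    (S.powerset.powerset.filter fun 𝒟 => G.IsPacking S 𝒟 ∧ 𝒟.card = m)
    (fun 𝒟 => toLex ((rest S 𝒟).card, G.degSum (rest S 𝒟)))
    ⟨𝒞, by simpa [Finset.subset_iff, h, hm] using h.subset⟩
  obtain ⟨-, h1, h2⟩ := Finset.mem_filter.1 h𝒟
  have best : ∀ ℰ, G.IsPacking S ℰ → ℰ.card = m → (rest S ℰ).card < (rest S 𝒟).card ∨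
      (rest S ℰ).card = (rest S 𝒟).card ∧ G.degSum (rest S ℰ) ≤ G.degSum (rest S 𝒟) := by
    intro ℰ hℰ hℰm
    have := hmax ℰ (by simpa [Finset.subset_iff, hℰ, hℰm] using hℰ.subset)
    rwa [Prod.Lex.le_iff] at this
  refine ⟨𝒟, h1, h2, hG, ?_, hd, best⟩
  have := best 𝒞 h hm
  omega

/-- The Corrádi–Hajnal theorem, with cycles replaced by cores. -/
theorem exists_isPacking {k : ℕ} (hS : 3 * k ≤ S.card) (hd : ∀ v ∈ S, 2 * k ≤ G.degIn S v) :
    ∃ 𝒞, G.IsPacking S 𝒞 ∧ 𝒞.card = k := by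
  rcases k with - | m
  · exact ⟨∅, ⟨by simp, by simp, by simp⟩, by simp⟩
  induction hN : ((S ×ˢ S).filter fun p => p.1 ≠ p.2 ∧ ¬ G.Adj p.1 p.2).card using
    Nat.strong_induction_on generalizing G with
  | _ N ih =>
    by_contra! hG
    by_cases hcomp : ∀ x ∈ S, ∀ y ∈ S, x ≠ y → G.Adj x y
    · obtain ⟨𝒞, h1, h2, -⟩ := exists_isPacking_of_complete hcomp hS
      exact hG 𝒞 h1 h2
    push Not at hcomp
    obtain ⟨x, hx, y, hy, hxy, hadj⟩ := hcomp
    have hle : G ≤ G ⊔ SimpleGraph.edge x y := le_sup_left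
    obtain ⟨𝒟, h𝒟, hm⟩ := ih _
      (hN ▸ card_nonadj_lt hle hx hy hxy hadj (Or.inr ((edge_adj ..).2 (by simp [hxy]))))
      (fun v hv => (hd v hv).trans (degIn_le_degIn fun w _ hw => hle hw)) rfl
    obtain ⟨𝒞, h1, h2, h3⟩ := h𝒟.sup_edge hm hG
    obtain ⟨ℰ, hℰ⟩ := exists_isExtremalPacking h1 h2 h3 hG fun v hv => by
      have := hd v hv
      omega
    exact hℰ.false

lemma IsCore.exists_cycleGraph_copy (h : G.IsCore T) :
    ∃ (n : ℕ) (f : Fin (n + 3) → α), Function.Injective f ∧ (∀ i, f i ∈ T) ∧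
      ∀ i, G.Adj (f i) (f (i + 1)) := by
  have hac : ¬ (G.induce (T : Set α)).IsAcyclic := by
    intro hac
    have : Nonempty (T : Set α) := h.nonempty.to_subtype
    obtain ⟨u, v, p, hp, hmax⟩ := Walk.exists_isPath_forall_isPath_length_le_length
      (G.induce (T : Set α))
    obtain ⟨a, ha, b, hb, hab⟩ := Finset.one_lt_card.1
      (show 1 < (T.filter (G.Adj u)).card from h.two_le u u.2)
    rw [Finset.mem_filter] at ha hb
    have key : ∀ w : (T : Set α), (G.induce (T : Set α)).Adj u w → w = p.snd := by
      intro w hw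
      refine hac.eq_snd_of_adj_start hp hw ?_
      by_contra hns
      have := hmax _ _ (p.cons hw.symm) (hp.cons hns)
      simp at this
    have h1 := key ⟨a, ha.1⟩ ha.2
    have h2 := key ⟨b, hb.1⟩ hb.2
    exact hab (congrArg Subtype.val (h1.trans h2.symm))
  rw [isAcyclic_iff_free_cycleGraph] at hac
  push Not at hac
  obtain ⟨n, hn, hfree⟩ := hac
  obtain ⟨n, rfl⟩ := Nat.exists_eq_add_of_le' hn
  obtain ⟨f⟩ := hfree
  refine ⟨n, fun i => (f i : α), fun i j hij => f.injective (Subtype.ext hij),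
    fun i => (f i).2, fun i => ?_⟩
  exact f.toHom.map_adj (show (cycleGraph (n + 3)).Adj i (i + 1) by simp [cycleGraph_adj])

end SimpleGraph

namespace SimpleGraph

variable {α : Type*} {F : SimpleGraph α}

lemma bddAbove_matching (hF : F.edgeSet.Finite) :
    BddAbove {m : ℕ | ∃ M : F.Subgraph, M.IsMatching ∧ M.edgeSet.ncard = m} := by
  refine ⟨F.edgeSet.ncard, ?_⟩
  rintro _ ⟨M, -, rfl⟩
  exact Set.ncard_le_ncard M.edgeSet_subset hF

lemma exists_isMatching_ncard_eq (hF : F.edgeSet.Finite) :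
    ∃ M : F.Subgraph, M.IsMatching ∧ M.edgeSet.ncard = F.matchingNumber := by
  have hne : {m : ℕ | ∃ M : F.Subgraph, M.IsMatching ∧ M.edgeSet.ncard = m}.Nonempty :=
    ⟨0, ⊥, fun v hv => False.elim hv, by simp⟩
  exact Nat.sSup_mem hne (bddAbove_matching hF)

lemma card_le_matchingNumber (hF : F.edgeSet.Finite) {ι : Type*} [Fintype ι] (x y : ι → α)
    (hxy : ∀ i, F.Adj (x i) (y i))
    (hd : Pairwise fun i j => Disjoint ({x i, y i} : Set α) {x j, y j}) :
    Fintype.card ι ≤ F.matchingNumber := by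
  have hM : (⨆ i, F.subgraphOfAdj (hxy i)).IsMatching :=
    Subgraph.IsMatching.iSup (fun i => Subgraph.IsMatching.subgraphOfAdj (hxy i)) fun i j hij => by
      simpa only [support_subgraphOfAdj] using hd hij
  have hinj : Function.Injective fun i => s(x i, y i) := by
    intro i j hij
    by_contra hne
    have hx : x i ∈ s(x j, y j) := (show s(x i, y i) = s(x j, y j) from hij) ▸
      Sym2.mem_mk_left _ _
    exact Set.disjoint_left.1 (hd hne) (Set.mem_insert _ _) (by simpa using hx)
  refine le_csSup (bddAbove_matching hF) ⟨_, hM, ?_⟩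
  have : (⨆ i, F.subgraphOfAdj (hxy i)).edgeSet = Set.range fun i => s(x i, y i) := by
    ext e
    simp [Subgraph.edgeSet_iSup, eq_comm]
  rw [this, ← Set.image_univ, Set.ncard_image_of_injective _ hinj, Set.ncard_univ,
    Nat.card_eq_fintype_card]

end SimpleGraph

namespace Graph

variable {α β : Type*} {G : Graph α β}

/-- The simple graph on the vertices of `G` in which distinct vertices are adjacent if and only if
some edge of `G` joins them. -/
def underlying (G : Graph α β) : SimpleGraph α where
  Adj x y := x ≠ y ∧ G.Adj x y
  symm := ⟨fun _ _ h => ⟨h.1.symm, h.2.symm⟩⟩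
  loopless := ⟨fun _ h => h.1 rfl⟩

/-- `G` contains `k` disjoint cycles with all vertices in `S`. -/
def HasDisjointCyclesIn (G : Graph α β) (S : Set α) (k : ℕ) : Prop :=
  ∃ C : Fin k → G.Cycle,
    (Pairwise fun i j => Disjoint (Set.range (C i).vert) (Set.range (C j).vert)) ∧
    ∀ i, Set.range (C i).vert ⊆ S

lemma HasDisjointCyclesIn.hasDisjointCycles {S : Set α} {k l : ℕ}
    (h : G.HasDisjointCyclesIn S l) (hkl : k ≤ l) : G.HasDisjointCycles k := by
  obtain ⟨C, hC, -⟩ := h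
  exact ⟨fun i => C (Fin.castLE hkl i), fun i j hij =>
    hC fun h => hij (Fin.castLE_injective hkl h)⟩

lemma HasDisjointCyclesIn.union {S T : Set α} {k l : ℕ} (hS : G.HasDisjointCyclesIn S k)
    (hT : G.HasDisjointCyclesIn T l) (hST : Disjoint S T) :
    G.HasDisjointCyclesIn (S ∪ T) (k + l) := by
  obtain ⟨C, hC, hCS⟩ := hS
  obtain ⟨D, hD, hDT⟩ := hT
  refine ⟨Fin.append C D, fun i j => ?_, fun i => ?_⟩
  · induction i using Fin.addCases with
    | left i =>
      induction j using Fin.addCases with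
      | left j =>
        beta_reduce
        rw [Fin.append_left, Fin.append_left]
        exact fun h => hC fun e => h (e ▸ rfl)
      | right j =>
        beta_reduce
        rw [Fin.append_left, Fin.append_right]
        exact fun _ => hST.mono (hCS i) (hDT j)
    | right i =>
      induction j using Fin.addCases with
      | left j =>
        beta_reduce
        rw [Fin.append_left, Fin.append_right]
        exact fun _ => (hST.mono (hCS j) (hDT i)).symm
      | right j =>
        beta_reduce
        rw [Fin.append_right, Fin.append_right]
        exact fun h => hD fun e => h (e ▸ rfl)
  · induction i using Fin.addCases with
    | left i =>
      rw [Fin.append_left]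
      exact (hCS i).trans Set.subset_union_left
    | right i =>
      rw [Fin.append_right]
      exact (hDT i).trans Set.subset_union_right

lemma hasDisjointCyclesIn_of_family {ι : Type*} [Fintype ι] {S : Set α} (T : ι → Set α)
    (hT : Pairwise fun i j => Disjoint (T i) (T j)) (hS : ∀ i, T i ⊆ S)
    (hC : ∀ i, ∃ C : G.Cycle, Set.range C.vert ⊆ T i) :
    G.HasDisjointCyclesIn S (Fintype.card ι) := by
  choose C hC using hC
  let e := (Fintype.equivFin ι).symm
  exact ⟨fun i => C (e i), fun i j hij => (hT (e.injective.ne hij)).mono (hC _) (hC _),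
    fun i => (hC _).trans (hS _)⟩

lemma exists_cycle_of_isLoopAt {e : β} {v : α} (h : G.IsLoopAt e v) :
    ∃ C : G.Cycle, Set.range C.vert ⊆ {v} :=
  ⟨⟨0, fun _ => v, fun _ => e, fun _ _ _ => Subsingleton.elim (α := Fin 1) _ _,
    fun _ _ _ => Subsingleton.elim (α := Fin 1) _ _, fun _ => h⟩, by simp⟩

lemma exists_cycle_of_strongGraph_adj {x y : α} (h : G.strongGraph.Adj x y) :
    ∃ C : G.Cycle, Set.range C.vert ⊆ {x, y} := by
  obtain ⟨hxy, -, -, e, f, hef, he, hf⟩ := h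
  refine ⟨⟨1, ![x, y], ![e, f], ?_, ?_, ?_⟩, ?_⟩
  · intro i j
    fin_cases i <;> fin_cases j <;> simp [hxy, hxy.symm]
  · intro i j
    fin_cases i <;> fin_cases j <;> simp [hef, hef.symm]
  · intro i
    fin_cases i
    · simpa using he
    · simpa using hf.symm
  · rintro _ ⟨i, rfl⟩
    fin_cases i <;> simp

lemma exists_cycle_of_isCore {T : Finset α} (h : G.underlying.IsCore T) :
    ∃ C : G.Cycle, Set.range C.vert ⊆ T := by
  obtain ⟨n, f, hinj, hT, hadj⟩ := h.exists_cycleGraph_copy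
  choose e he using fun i => (hadj i).2
  refine ⟨⟨n + 2, f, e, hinj, fun i j hij => ?_, he⟩, Set.range_subset_iff.2 hT⟩
  rcases (he i).eq_and_eq_or_eq_and_eq (hij ▸ he j) with ⟨h1, -⟩ | ⟨h1, h2⟩
  · exact hinj h1
  · have h1 := hinj h1
    have h2 := hinj h2
    rw [h1, add_assoc] at h2
    have h3 : (1 + 1 : Fin (n + 3)) = 0 := by simpa using h2
    have h4 := congrArg Fin.val h3
    simp [Fin.val_add, Nat.mod_eq_of_lt] at h4

lemma loopVertices_subset : G.loopVertices ⊆ V(G) := by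
  rintro v ⟨e, he⟩
  exact he.left_mem

lemma finite_edgeSet_strongGraph (hfin : V(G).Finite) : G.strongGraph.edgeSet.Finite := by
  refine (hfin.toFinset.sym2.finite_toSet).subset fun e he => ?_
  induction e with
  | _ x y =>
    obtain ⟨-, -, -, e, f, -, he, -⟩ := he
    simp [he.left_mem, he.right_mem]

lemma simpleDegree_eq (hfin : V(G).Finite) (v : α) :
    G.simpleDegree v = G.underlying.degIn hfin.toFinset v := by
  rw [simpleDegree, SimpleGraph.degIn, ← Set.ncard_coe_finset]
  congr 1
  ext w
  rw [Finset.mem_coe, Finset.mem_filter, hfin.mem_toFinset]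
  exact ⟨fun h => ⟨h.2.right_mem, h.1.symm, h.2⟩, fun h => ⟨h.2.1.symm, h.2.2⟩⟩

lemma hasDisjointCyclesIn_loopVertices (hfin : V(G).Finite) :
    G.HasDisjointCyclesIn G.loopVertices G.loopVertices.ncard := by
  have := (hfin.subset G.loopVertices_subset).fintype
  rw [← Nat.card_coe_set_eq, Nat.card_eq_fintype_card]
  refine hasDisjointCyclesIn_of_family (fun v : G.loopVertices => {v.1}) ?_ ?_ ?_
  · intro v w hvw
    simpa [Subtype.ext_iff] using hvw
  · simp
  · rintro ⟨v, e, he⟩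
    exact exists_cycle_of_isLoopAt he

lemma exists_hasDisjointCyclesIn_matching (hfin : V(G).Finite) {t : ℕ}
    (ht : t ≤ G.strongGraph.matchingNumber) :
    ∃ U : Finset α, U.card ≤ 2 * t ∧ (U : Set α) ⊆ V(G) ∧ Disjoint G.loopVertices U ∧
      G.HasDisjointCyclesIn U t := by
  obtain ⟨M, hM, hcard⟩ := SimpleGraph.exists_isMatching_ncard_eq (G.finite_edgeSet_strongGraph hfin)
  have hMfin := (G.finite_edgeSet_strongGraph hfin).subset M.edgeSet_subset
  rw [← hcard, Set.ncard_eq_toFinset_card _ hMfin] at ht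
  obtain ⟨E, hE, rfl⟩ := Finset.exists_subset_card_eq ht
  have hE' : ∀ e ∈ E, e ∈ M.edgeSet := fun e he => by simpa using hE he
  have hmem : ∀ e ∈ E, ∀ v ∈ e, v ∈ V(G) ∧ v ∉ G.loopVertices := by
    intro e he v hv
    obtain ⟨w, rfl⟩ := hv
    obtain ⟨-, h, -, e, f, -, hl, -⟩ := M.adj_sub (hE' _ he)
    exact ⟨hl.left_mem, h⟩
  refine ⟨E.biUnion Sym2.toFinset, ?_, ?_, ?_, ?_⟩
  · refine (Finset.card_biUnion_le_card_mul _ _ 2 fun e _ => ?_).trans (mul_comm _ _).le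
    rw [Sym2.card_toFinset]
    split_ifs <;> omega
  · intro v hv
    simp only [Finset.coe_biUnion, Set.mem_iUnion, Finset.mem_coe, Sym2.mem_toFinset] at hv
    obtain ⟨e, he, hv⟩ := hv
    exact (hmem e he v hv).1
  · refine Set.disjoint_right.2 fun v hv => ?_
    simp only [Finset.coe_biUnion, Set.mem_iUnion, Finset.mem_coe, Sym2.mem_toFinset] at hv
    obtain ⟨e, he, hv⟩ := hv
    exact (hmem e he v hv).2
  · rw [← Fintype.card_coe]
    refine hasDisjointCyclesIn_of_family (fun e : E => {v | v ∈ e.1}) ?_ ?_ ?_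
    · rintro ⟨e, he⟩ ⟨f, hf⟩ hef
      refine Set.disjoint_left.2 fun v hve hvf => hef (Subtype.ext ?_)
      obtain ⟨a, rfl⟩ := hve
      obtain ⟨b, rfl⟩ := hvf
      exact congrArg (fun w => s(v, w)) (hM.eq_of_adj_left (hE' _ he) (hE' _ hf))
    · rintro ⟨e, he⟩ v hv
      simpa using ⟨e, he, hv⟩
    · rintro ⟨e, he⟩
      induction e with
      | _ x y =>
        obtain ⟨C, hC⟩ := exists_cycle_of_strongGraph_adj (M.adj_sub (hE' _ he))
        exact ⟨C, fun v hv => by simpa using hC hv⟩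

lemma hasDisjointCyclesIn_of_isPacking {S : Finset α} {𝒞 : Finset (Finset α)}
    (h : G.underlying.IsPacking S 𝒞) : G.HasDisjointCyclesIn S 𝒞.card := by
  rw [← Fintype.card_coe]
  refine hasDisjointCyclesIn_of_family (fun C : 𝒞 => (C.1 : Set α)) ?_ ?_ ?_
  · rintro ⟨C, hC⟩ ⟨D, hD⟩ hne
    exact Finset.disjoint_coe.2 (h.pairwiseDisjoint hC hD fun e => hne (Subtype.ext e))
  · rintro ⟨C, hC⟩
    exact Finset.coe_subset.2 (h.subset C hC)
  · rintro ⟨C, hC⟩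
    exact exists_cycle_of_isCore (h.isCore C hC)

theorem hasDisjointCycles_of_le (hfin : V(G).Finite) {k : ℕ}
    (hdeg : ∀ v ∈ V(G), 2 * k - 1 ≤ G.simpleDegree v) (hloop : ∃ e v, G.IsLoopAt e v)
    (h : 3 * k ≤ V(G).ncard + 2 * G.loopVertices.ncard + G.strongGraph.matchingNumber) :
    G.HasDisjointCycles k := by
  have hL := hasDisjointCyclesIn_loopVertices hfin
  have hLfin := hfin.subset G.loopVertices_subset
  set L := hLfin.toFinset with hLdef
  have hLL : (L : Set α) = G.loopVertices := hLfin.coe_toFinset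
  have hVV : (hfin.toFinset : Set α) = V(G) := hfin.coe_toFinset
  rw [← hLL, Set.ncard_coe_finset] at hL h
  rw [← hVV, Set.ncard_coe_finset] at h
  have hLV : L ⊆ hfin.toFinset := by
    rw [← Finset.coe_subset, hLL, hVV]
    exact loopVertices_subset
  have hLpos : 0 < L.card := by
    obtain ⟨e, v, he⟩ := hloop
    exact Finset.card_pos.2 ⟨v, by rw [hLdef, Set.Finite.mem_toFinset]; exact ⟨e, he⟩⟩
  rcases le_total k L.card with hkL | hkL
  · exact hL.hasDisjointCycles hkL
  obtain ⟨U, hUcard, hUV, hLU, hU⟩ := exists_hasDisjointCyclesIn_matching hfin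
    (min_le_left G.strongGraph.matchingNumber (k - L.card))
  set t := min G.strongGraph.matchingNumber (k - L.card) with ht
  rw [← hLL] at hLU
  rw [← hVV, Finset.coe_subset] at hUV
  have hLU' : Disjoint L U := Finset.disjoint_coe.1 hLU
  have hsub : L ∪ U ⊆ hfin.toFinset := Finset.union_subset hLV hUV
  have hcard := Finset.card_sdiff_add_card_eq_card hsub
  have hLUcard := Finset.card_union_of_disjoint hLU'
  obtain ⟨𝒞, h𝒞, hc⟩ := SimpleGraph.exists_isPacking (G := G.underlying)
    (S := hfin.toFinset \ (L ∪ U)) (k := k - L.card - t) (by omega) (by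
      intro v hv
      have h1 := hdeg v (by simpa using (Finset.mem_sdiff.1 hv).1)
      rw [simpleDegree_eq hfin, ← Finset.sdiff_union_of_subset hsub,
        SimpleGraph.degIn_union Finset.sdiff_disjoint] at h1
      have h2 := SimpleGraph.degIn_le_card (G := G.underlying) (S := L ∪ U) v
      omega)
  have hS := hasDisjointCyclesIn_of_isPacking h𝒞
  refine ((hL.union hU hLU).union hS ?_).hasDisjointCycles (by omega)
  rw [← Finset.coe_union, Finset.disjoint_coe]
  exact Finset.disjoint_sdiff

theorem le_of_hasDisjointCycles (hfin : V(G).Finite) {k : ℕ} (h : G.HasDisjointCycles k) :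
    3 * k ≤ V(G).ncard + 2 * G.loopVertices.ncard + G.strongGraph.matchingNumber := by
  obtain ⟨C, hC⟩ := h
  have hLfin := hfin.subset G.loopVertices_subset
  set L := hLfin.toFinset with hLdef
  have hLL : (L : Set α) = G.loopVertices := hLfin.coe_toFinset
  have hmemL : ∀ v, v ∈ L ↔ v ∈ G.loopVertices := fun v => hLfin.mem_toFinset
  rw [← hLL, Set.ncard_coe_finset, Set.ncard_eq_toFinset_card _ hfin]
  set R : Fin k → Finset α := fun i => Finset.univ.image (C i).vert with hR
  have hRcard : ∀ i, (R i).card = (C i).n + 1 := fun i => by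
    rw [hR, Finset.card_image_of_injective _ (C i).vert_injective, Finset.card_univ,
      Fintype.card_fin]
  have hRd : Pairwise fun i j => Disjoint (R i) (R j) := fun i j hij => by
    beta_reduce
    rw [← Finset.disjoint_coe]
    simpa [hR] using hC hij
  have h1 : ∑ i, (R i).card ≤ hfin.toFinset.card := by
    rw [← Finset.card_biUnion fun i _ j _ hij => hRd hij]
    refine Finset.card_le_card (Finset.biUnion_subset.2 fun i _ => ?_)
    refine Finset.image_subset_iff.2 fun j _ => ?_
    simpa using ((C i).isLink j).left_mem
  have h2 : ∑ i, (R i ∩ L).card ≤ L.card := by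
    rw [← Finset.card_biUnion fun i _ j _ hij =>
      (hRd hij).mono Finset.inter_subset_left Finset.inter_subset_left]
    exact Finset.card_le_card (Finset.biUnion_subset.2 fun i _ => Finset.inter_subset_right)
  have h3 : (Finset.univ.filter fun i => (C i).n = 1 ∧ Disjoint (R i) L).card ≤
      G.strongGraph.matchingNumber := by
    rw [← Fintype.card_coe]
    refine SimpleGraph.card_le_matchingNumber (finite_edgeSet_strongGraph hfin)
      (fun i => (C i.1).vert 0) (fun i => (C i.1).vert 1) ?_ ?_
    · rintro ⟨i, hi⟩
      obtain ⟨hn, hd⟩ := (Finset.mem_filter.1 hi).2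
      have hnL : ∀ j, (C i).vert j ∉ G.loopVertices := fun j hj =>
        Finset.disjoint_left.1 hd (Finset.mem_image_of_mem _ (Finset.mem_univ j))
          ((hmemL _).2 hj)
      have h01 : (0 : Fin ((C i).n + 1)) ≠ 1 := by
        intro h
        have := congrArg Fin.val h
        simp [hn] at this
      have h10 : (1 : Fin ((C i).n + 1)) + 1 = 0 := by
        ext
        simp [Fin.val_add, hn]
      refine ⟨(C i).vert_injective.ne h01, hnL 0, hnL 1, (C i).edge 0, (C i).edge 1,
        (C i).edge_injective.ne h01, ?_, ?_⟩
      · simpa using (C i).isLink 0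
      · simpa [h10] using ((C i).isLink 1).symm
    · rintro ⟨i, hi⟩ ⟨j, hj⟩ hij
      refine (hC fun e => hij (Subtype.ext e)).mono ?_ ?_ <;>
      · rintro _ (rfl | rfl)
        exacts [⟨_, rfl⟩, ⟨_, rfl⟩]
  have h4 : ∀ i, 3 ≤ (R i).card + 2 * (R i ∩ L).card +
      if (C i).n = 1 ∧ Disjoint (R i) L then 1 else 0 := by
    intro i
    rw [hRcard]
    by_cases hd : Disjoint (R i) L
    · have hn : (C i).n ≠ 0 := by
        intro hn
        have h00 : (0 : Fin ((C i).n + 1)) + 1 = 0 := by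
          ext
          simp [hn]
        have hl := (C i).isLink 0
        rw [h00] at hl
        exact Finset.disjoint_left.1 hd (Finset.mem_image_of_mem _ (Finset.mem_univ 0))
          ((hmemL _).2 ⟨_, hl⟩)
      by_cases hn1 : (C i).n = 1
      · simp [hd, hn1]
      · omega
    · have := Finset.card_pos.2 (Finset.not_disjoint_iff_nonempty_inter.1 hd)
      omega
  have h5 := Finset.sum_le_sum fun i (_ : i ∈ Finset.univ) => h4 i
  rw [Finset.sum_add_distrib, Finset.sum_add_distrib, ← Finset.mul_sum, ← Finset.card_filter,
    Finset.sum_const, Finset.card_univ, Fintype.card_fin, smul_eq_mul] at h5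
  omega

end Graph

end DisjointCycles

theorem corollary2p3 {α β : Type*} (G : Graph α β) (hfin : V(G).Finite) (k : ℕ) (hk : 2 ≤ k)
    (hdeg : ∀ v ∈ V(G), 2 * k - 1 ≤ G.simpleDegree v)
    (hloop : ∃ e v, G.IsLoopAt e v) :
    ¬ G.HasDisjointCycles k ↔
      V(G).ncard + 2 * G.loopVertices.ncard + G.strongGraph.matchingNumber < 3 * k := by
  rw [← not_le, not_iff_not]
  exact ⟨Graph.le_of_hasDisjointCycles hfin, Graph.hasDisjointCycles_of_le hfin hdeg hloop⟩
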